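/- Let $G$ be a finite simple graph and $k\ge 1$ an integer. Two distinct proper $k$-colourings $V(G)\to\{1,\dots,k\}$ are called adjacent if they differ on exactly one vertex; a cluster is a connected component of the resulting graph on the set of all proper $k$-colourings of $G$. A vertex $v$ is frozen in a proper $k$-colouring $\tau$ if $\sigma(v)=\tau(v)$ for every $\sigma$ in the same cluster as $\tau$. Proposition. For all integers $g\ge 3$ and $d\ge 3$ there are constants $c,C>0$ (depending only on $g$ and $d$), an integer $N$, and, for every $n\ge N$ with $dn$ even, a $d$-regular graph $G_n$ on $n$ vertices of girth at least $g$, such that, if $\boldsymbol\sigma_n$ is a uniformly random proper $(d+1)$-colouring of $G_n$ and $X_n$ is the number of vertices of $G_n$ that are frozen in $\boldsymbol\sigma_n$, then \[ \Pr\big(c\,n\le X_n\le C\,n\big)\longrightarrow 1 \] as $n\to\infty$ along the integers $n$ with $dn$ even. -/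

import Mathlib

/-- The distance-`t` `k`-colouring graph: its vertices are the proper `k`-colourings of `G`, and
two distinct colourings are adjacent if their Hamming distance is at most `t`. -/
def colouringGraph {V : Type*} [Fintype V] (G : SimpleGraph V) (k t : ℕ) :
    SimpleGraph (G.Coloring (Fin k)) where
  Adj τ σ := τ ≠ σ ∧ hammingDist (fun v => τ v) (fun v => σ v) ≤ t
  symm := ⟨fun _ _ h => ⟨h.1.symm, by rw [hammingDist_comm]; exact h.2⟩⟩
  loopless := ⟨fun _ h => h.1 rfl⟩

/-- The vertex `v` is `t`-frozen in the proper `k`-colouring `τ`: every colouring in the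
same `t`-cluster (connected component of the distance-`t` colouring graph) gives `v` the
same colour as `τ`. -/
def IsFrozen {V : Type*} [Fintype V] {G : SimpleGraph V} {k : ℕ} (t : ℕ)
    (τ : G.Coloring (Fin k)) (v : V) : Prop :=
  ∀ σ : G.Coloring (Fin k), (colouringGraph G k t).Reachable τ σ → τ v = σ v

/-- The number of frozen (that is, `1`-frozen) vertices in `τ`. -/
noncomputable def numFrozen {V : Type*} [Fintype V] {G : SimpleGraph V} {k : ℕ}
    (τ : G.Coloring (Fin k)) : ℕ :=
  {v : V | IsFrozen 1 τ v}.ncard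

/-- All sets of colourings are events. -/
instance colouringMeasurableSpace {V : Type*} (G : SimpleGraph V) (k : ℕ) :
    MeasurableSpace (G.Coloring (Fin k)) := ⊤

/-- The law of a uniformly random proper `k`-colouring of `G`. -/
noncomputable def uniformColouring {V : Type*} (G : SimpleGraph V) (k : ℕ) :
    MeasureTheory.Measure (G.Coloring (Fin k)) :=
  ProbabilityTheory.uniformOn Set.univ

open Classical in
/-- `G` is `d`-regular (Mathlib's notion, with classical decidability of adjacency). -/
def IsRegularGraph {V : Type*} [Fintype V] (G : SimpleGraph V) (d : ℕ) : Prop :=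
  G.IsRegularOfDegree d

/-! Call a colouring *rainbow* if every vertex sees all the colours other than its own. A copy of a
graph which carries a rainbow colouring is frozen: no single vertex of it can be recoloured, so the
restriction to the copy never changes within a cluster. The identity colouring of `K_{d+1}` is
rainbow and stays so when pulled back to a lift; a lift `H` of large girth is obtained by giving the
edges as voltages involutions of a finite set of words whose short reduced products are distinct.

The graph on `n` vertices consists of disjoint copies of `H` and a bounded remainder. The remainder
corrects for the residue of `n` modulo the order of `H`: one deletes an edge in some copies of `H`
and joins the loose ends to new vertices, which creates no short cycles. In a uniformly random
colouring the copies of `H` are coloured independently and uniformly, so each of them carries the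
rainbow colouring with a fixed positive probability, and by Hoeffding's inequality a linear number
of them do so, except with exponentially small probability.
-/

section Regular

variable {V W ι : Type*} [Fintype V] [Fintype W] [Fintype ι]
  {G : SimpleGraph V} {H : SimpleGraph W} {d : ℕ}

theorem isRegularGraph_iff_ncard_neighborSet :
    IsRegularGraph G d ↔ ∀ v, (G.neighborSet v).ncard = d := by
  classical
  simp only [IsRegularGraph, SimpleGraph.IsRegularOfDegree, Set.ncard_eq_toFinset_card',
    ← SimpleGraph.neighborFinset_def, SimpleGraph.card_neighborFinset_eq_degree]

theorem isRegularGraph_top :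
    IsRegularGraph (⊤ : SimpleGraph V) (Fintype.card V - 1) := by
  rw [isRegularGraph_iff_ncard_neighborSet]
  intro v
  rw [SimpleGraph.neighborSet_top, Set.ncard_compl, Set.ncard_singleton, Nat.card_eq_fintype_card]

theorem IsRegularGraph.even_mul_card (hG : IsRegularGraph G d) : Even (d * Fintype.card V) := by
  classical
  have hsum := G.sum_degrees_eq_twice_card_edges
  simp only [hG.degree_eq, Finset.sum_const, Finset.card_univ, smul_eq_mul] at hsum
  exact ⟨_, by rw [mul_comm, hsum, two_mul]⟩

theorem IsRegularGraph.exists_adj (hG : IsRegularGraph G d) (hd : 0 < d) (v : V) :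
    ∃ w, G.Adj v w :=
  Set.nonempty_of_ncard_ne_zero (isRegularGraph_iff_ncard_neighborSet.1 hG v ▸ hd.ne')

theorem IsRegularGraph.of_iso (hH : IsRegularGraph H d) (φ : G ≃g H) : IsRegularGraph G d := by
  rw [isRegularGraph_iff_ncard_neighborSet] at hH ⊢
  exact fun v => (Set.ncard_congr' (φ.mapNeighborSet v)).trans (hH (φ v))

theorem IsRegularGraph.sum (hG : IsRegularGraph G d) (hH : IsRegularGraph H d) :
    IsRegularGraph (G ⊕g H) d := by
  rw [isRegularGraph_iff_ncard_neighborSet] at hG hH ⊢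
  rintro (v | w)
  · rw [SimpleGraph.neighborSet_sum_inl, Set.ncard_image_of_injective _ Sum.inl_injective, hG]
  · rw [SimpleGraph.neighborSet_sum_inr, Set.ncard_image_of_injective _ Sum.inr_injective, hH]

theorem IsRegularGraph.bot_boxProd (hG : IsRegularGraph G d) :
    IsRegularGraph ((⊥ : SimpleGraph ι) □ G) d := by
  rw [isRegularGraph_iff_ncard_neighborSet] at hG ⊢
  intro a
  rw [SimpleGraph.neighborSet_boxProd, SimpleGraph.neighborSet_bot, Set.empty_prod, Set.empty_union,
    Set.singleton_prod, Set.ncard_image_of_injective _ (Prod.mk_right_injective a.1), hG]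

end Regular

section Girth

variable {V W ι : Type*} {G : SimpleGraph V} {H : SimpleGraph W}

theorem egirth_le_length_add_one_of_adj {u v : V} (huv : G.Adj u v) (p : G.Walk v u)
    (hp : s(u, v) ∉ p.edges) : G.egirth ≤ p.length + 1 := by
  classical
  have hcycle : (p.bypass.cons huv).IsCycle := (p.bypass.cons_isCycle_iff huv).2
    ⟨p.bypass_isPath, fun h => hp (p.edges_bypass_subset_edges h)⟩
  calc G.egirth ≤ (p.bypass.cons huv).length := SimpleGraph.egirth_le_length hcycle
    _ ≤ p.length + 1 := by exact_mod_cast Nat.succ_le_succ p.length_bypass_le_length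

theorem egirth_le_length_of_support_subset_range (φ : H ↪g G) {v : V} {c : G.Walk v v}
    (hc : c.IsCycle) (hsupp : ∀ u ∈ c.support, u ∈ Set.range φ) : H.egirth ≤ c.length := by
  have hinduce : (c.induce _ hsupp).IsCycle :=
    .of_map (f := (SimpleGraph.Embedding.induce (Set.range φ)).toHom) <| by
      rwa [SimpleGraph.Walk.map_induce]
  calc H.egirth = (G.induce (Set.range φ)).egirth := φ.isoInduceRange.egirth_eq
    _ ≤ (c.induce _ hsupp).length := SimpleGraph.egirth_le_length hinduce
    _ = c.length := by
      exact_mod_cast (SimpleGraph.Walk.length_map ..).symm.trans <|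
        congrArg SimpleGraph.Walk.length (c.map_induce hsupp)

theorem egirth_le_length_of_adj_mem_range (φ : H ↪g G)
    (hφ : ∀ v x, G.Adj (φ v) x → x ∈ Set.range φ) {x : V} {c : G.Walk x x} (hc : c.IsCycle)
    (hx : x ∈ Set.range φ) : H.egirth ≤ c.length := by
  have hsupp : ∀ {x y} (p : G.Walk x y), x ∈ Set.range φ → ∀ u ∈ p.support, u ∈ Set.range φ := by
    intro x y p hx
    induction p with
    | nil => simpa using hx
    | cons hadj p ih =>
      obtain ⟨v, rfl⟩ := hx
      simpa using ih (hφ v _ hadj)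
  exact egirth_le_length_of_support_subset_range φ hc (hsupp c hx)

theorem le_egirth_sum {n : ℕ∞} (hG : n ≤ G.egirth) (hH : n ≤ H.egirth) :
    n ≤ (G ⊕g H).egirth := by
  rw [SimpleGraph.le_egirth]
  rintro (v | w) c hc
  · refine hG.trans <| egirth_le_length_of_adj_mem_range .sumInl ?_ hc ⟨v, rfl⟩
    rintro u (x | x) hux
    · exact ⟨x, rfl⟩
    · simp at hux
  · refine hH.trans <| egirth_le_length_of_adj_mem_range .sumInr ?_ hc ⟨w, rfl⟩
    rintro u (x | x) hux
    · simp at hux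
    · exact ⟨x, rfl⟩

theorem egirth_le_egirth_bot_boxProd : H.egirth ≤ ((⊥ : SimpleGraph ι) □ H).egirth := by
  rw [SimpleGraph.le_egirth]
  rintro ⟨i, v⟩ c hc
  refine egirth_le_length_of_adj_mem_range (SimpleGraph.boxProdRight ⊥ H i) ?_ hc ⟨v, rfl⟩
  rintro u ⟨j, x⟩ hux
  have hji : i = j := (by simpa [SimpleGraph.boxProd_adj] using hux : _ ∧ _).2
  exact ⟨x, by simp [hji]⟩

end Girth

section ReducedWords

variable {E : Type*} {L : ℕ}

/-- The words of length at most `L` over `E` without two equal consecutive letters. They form the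
ball of radius `L` in the Cayley graph of the free product of copies of `ℤ/2` indexed by `E`. -/
def reducedWords (E : Type*) (L : ℕ) : Set (List E) :=
  {l | l.length ≤ L ∧ l.IsChain (· ≠ ·)}

theorem finite_reducedWords [Finite E] : (reducedWords E L).Finite :=
  (List.finite_length_le E L).subset fun _ hl => hl.1

theorem nil_mem_reducedWords : [] ∈ reducedWords E L :=
  ⟨Nat.zero_le L, .nil⟩

open Classical in
/-- Multiplication of the word `l` by the involution `e`, truncated so as to preserve the words of
length at most `L`. -/
noncomputable def toggleLetter (L : ℕ) (e : E) (l : List E) : List E :=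
  if l.head? = some e then l.tail else if l.length < L then e :: l else l

theorem toggleLetter_mem_reducedWords (e : E) {l : List E} (hl : l ∈ reducedWords E L) :
    toggleLetter L e l ∈ reducedWords E L := by
  obtain ⟨hlen, hchain⟩ := hl
  unfold toggleLetter
  split_ifs with hhead hlt
  · exact ⟨l.length_tail.trans_le ((Nat.sub_le _ _).trans hlen), hchain.tail⟩
  · exact ⟨hlt, List.isChain_cons.2 ⟨fun x hx hex => hhead (hex ▸ hx), hchain⟩⟩
  · exact ⟨hlen, hchain⟩

theorem toggleLetter_of_cons_mem {e : E} {l : List E} (hl : e :: l ∈ reducedWords E L) :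
    toggleLetter L e l = e :: l := by
  have hhead : l.head? ≠ some e := fun h => (List.isChain_cons.1 hl.2).1 e h rfl
  rw [toggleLetter, if_neg hhead, if_pos (show l.length < L from hl.1)]

theorem toggleLetter_cons_self (e : E) (l : List E) : toggleLetter L e (e :: l) = l :=
  if_pos rfl

theorem toggleLetter_toggleLetter (e : E) {l : List E} (hl : l ∈ reducedWords E L) :
    toggleLetter L e (toggleLetter L e l) = l := by
  by_cases hhead : l.head? = some e
  · obtain ⟨l, rfl⟩ := List.head?_eq_some_iff.1 hhead
    rw [toggleLetter_cons_self, toggleLetter_of_cons_mem hl]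
  · by_cases hlt : l.length < L <;> simp [toggleLetter, hhead, hlt]

/-- The involution of `reducedWords E L` which toggles the letter `e` at the head of a word. -/
noncomputable def togglePerm (L : ℕ) (e : E) : Equiv.Perm (reducedWords E L) :=
  Function.Involutive.toPerm
    (fun l => ⟨toggleLetter L e l, toggleLetter_mem_reducedWords e l.2⟩)
    fun l => Subtype.ext (toggleLetter_toggleLetter e l.2)

theorem togglePerm_mul_self (e : E) : togglePerm L e * togglePerm L e = 1 :=
  Equiv.ext fun l => Subtype.ext (toggleLetter_toggleLetter e l.2)

theorem prod_map_togglePerm_apply_nil {l : List E} (hl : l ∈ reducedWords E L) :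
    (l.map (togglePerm L)).prod ⟨[], nil_mem_reducedWords⟩ = ⟨l, hl⟩ := by
  induction l with
  | nil => rfl
  | cons e l ih =>
    have hl' : l ∈ reducedWords E L := ⟨(Nat.le_succ _).trans hl.1, hl.2.tail⟩
    rw [List.map_cons, List.prod_cons, Equiv.Perm.mul_apply, ih hl']
    exact Subtype.ext (toggleLetter_of_cons_mem hl)

theorem injOn_prod_map_togglePerm :
    Set.InjOn (fun l => (l.map (togglePerm L)).prod) (reducedWords E L) := by
  intro l hl l' hl' h
  have happly := congrArg (fun π => π ⟨[], nil_mem_reducedWords⟩) h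
  simpa only [prod_map_togglePerm_apply_nil hl, prod_map_togglePerm_apply_nil hl',
    Subtype.mk.injEq] using happly

end ReducedWords

section VoltageLift

variable {κ Γ : Type*} [Group Γ] {B : SimpleGraph κ} {t : Sym2 κ → Γ}
  {ht : ∀ e, t e * t e = 1} {L d : ℕ}

/-- The lift of the graph `B` with the voltage `t e` on the edge `e`. Voltages are involutions, so
edges need no orientation. -/
def voltageLift (B : SimpleGraph κ) (t : Sym2 κ → Γ) (ht : ∀ e, t e * t e = 1) :
    SimpleGraph (κ × Γ) where
  Adj a b := B.Adj a.1 b.1 ∧ b.2 = t s(a.1, b.1) * a.2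
  symm := ⟨fun a b h => ⟨h.1.symm, by rw [h.2, Sym2.eq_swap, ← mul_assoc, ht, one_mul]⟩⟩
  loopless := ⟨fun _ h => h.1.ne rfl⟩

/-- The covering map from the lift to the base graph. -/
def voltageLiftHom (ht : ∀ e, t e * t e = 1) : voltageLift B t ht →g B where
  toFun := Prod.fst
  map_rel' h := h.1

theorem neighborSet_voltageLift (a : κ × Γ) : (voltageLift B t ht).neighborSet a =
    (fun c => (c, t s(a.1, c) * a.2)) '' B.neighborSet a.1 := by
  ext ⟨c, x⟩
  constructor
  · rintro ⟨hac, hx⟩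
    exact ⟨c, hac, Prod.ext rfl hx.symm⟩
  · rintro ⟨c, hac, hcx⟩
    cases hcx
    exact ⟨hac, rfl⟩

theorem IsRegularGraph.voltageLift [Fintype κ] [Fintype Γ] (hB : IsRegularGraph B d)
    (ht : ∀ e, t e * t e = 1) : IsRegularGraph (voltageLift B t ht) d := by
  rw [isRegularGraph_iff_ncard_neighborSet] at hB ⊢
  intro a
  rw [neighborSet_voltageLift, Set.ncard_image_of_injective _ fun _ _ h => (Prod.ext_iff.1 h).1, hB]

/-- The edges of the base graph below the edges of a walk in the lift. -/
def baseEdges {u v : κ × Γ} (p : (voltageLift B t ht).Walk u v) : List (Sym2 κ) :=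
  p.edges.map (Sym2.map Prod.fst)

theorem prod_map_baseEdges_mul {u v : κ × Γ} (p : (voltageLift B t ht).Walk u v) :
    ((baseEdges p).map t).prod * v.2 = u.2 := by
  induction p with
  | nil => simp [baseEdges]
  | @cons u w v huw p ih =>
    calc t s(u.1, w.1) * ((baseEdges p).map t).prod * v.2
        = t s(u.1, w.1) * w.2 := by rw [mul_assoc, ih]
      _ = u.2 := by rw [huw.2, ← mul_assoc, ht, one_mul]

theorem isChain_baseEdges {u v : κ × Γ} {p : (voltageLift B t ht).Walk u v} (hp : p.IsPath) :
    (baseEdges p).IsChain (· ≠ ·) := by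
  induction p with
  | nil => exact .nil
  | @cons u w v huw p ih =>
    obtain ⟨hp, hu⟩ := (SimpleGraph.Walk.cons_isPath_iff huw p).1 hp
    refine List.isChain_cons.2 ⟨?_, ih hp⟩
    cases p with
    | nil => exact fun _ he => nomatch he
    | @cons _ x _ hwx q =>
      rintro _ ⟨⟩ (he : s(u.1, w.1) = s(w.1, x.1))
      have hux : u = x := by
        refine Prod.ext (Sym2.congr_right.1 (Sym2.eq_swap.trans he)) ?_
        rw [hwx.2, ← he, huw.2, ← mul_assoc, ht, one_mul]
      exact hu (by simp [hux])

theorem le_egirth_voltageLift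
    (hinj : Set.InjOn (fun l => (l.map t).prod) (reducedWords (Sym2 κ) L)) :
    (L + 2 : ℕ) ≤ (voltageLift B t ht).egirth := by
  rw [SimpleGraph.le_egirth]
  intro v c hc
  by_contra! hlt
  have hlt : c.length < L + 2 := by exact_mod_cast hlt
  have hthree := hc.three_le_length
  cases c with
  | nil => simp at hthree
  | @cons _ w _ hvw p =>
    have hp : p.IsPath := ((p.cons_isCycle_iff hvw).1 hc).1
    rw [SimpleGraph.Walk.length_cons] at hlt hthree
    have hlen : (baseEdges p).length = p.length := by simp [baseEdges]
    have hprod : ((baseEdges p).map t).prod = ([s(v.1, w.1)].map t).prod := by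
      apply mul_right_cancel (b := v.2)
      simpa using (prod_map_baseEdges_mul p).trans hvw.2
    -- The first edge of a short cycle and the path closing it have the same total voltage.
    have hword : baseEdges p = [s(v.1, w.1)] :=
      hinj ⟨by omega, isChain_baseEdges hp⟩ ⟨by simp; omega, .singleton _⟩ hprod
    rw [hword, List.length_singleton] at hlen
    omega

end VoltageLift

section Rainbow

variable {V κ C Γ : Type*} {H : SimpleGraph V}

/-- In the colouring `τ` every vertex sees all the colours other than its own. -/
def IsRainbow (τ : H.Coloring C) : Prop :=
  ∀ v c, τ v ≠ c → ∃ w, H.Adj v w ∧ τ w = c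

theorem isRainbow_top_id :
    IsRainbow (SimpleGraph.Coloring.mk id id : (⊤ : SimpleGraph κ).Coloring κ) :=
  fun _ c hc => ⟨c, hc, rfl⟩

theorem IsRainbow.comp_voltageLiftHom [Group Γ] {B : SimpleGraph κ} {t : Sym2 κ → Γ}
    {τ : B.Coloring C} (hτ : IsRainbow τ) (ht : ∀ e, t e * t e = 1) :
    IsRainbow (τ.comp (voltageLiftHom ht)) := by
  intro a c hac
  obtain ⟨b, hab, hb⟩ := hτ a.1 c hac
  exact ⟨(b, t s(a.1, b) * a.2), ⟨hab, rfl⟩, hb⟩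

theorem exists_isRegularGraph_isRainbow (g d : ℕ) :
    ∃ (V : Type) (_ : Fintype V) (_ : Nonempty V) (H : SimpleGraph V)
      (τ : H.Coloring (Fin (d + 1))), IsRegularGraph H d ∧ g ≤ H.egirth ∧ IsRainbow τ := by
  classical
  have := (finite_reducedWords (E := Sym2 (Fin (d + 1))) (L := g)).fintype
  have htop : IsRegularGraph (⊤ : SimpleGraph (Fin (d + 1))) d := by
    simpa using isRegularGraph_top (V := Fin (d + 1))
  refine ⟨_, inferInstance, inferInstance, voltageLift ⊤ (togglePerm g) togglePerm_mul_self, _,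
    htop.voltageLift _, le_trans ?_ (le_egirth_voltageLift injOn_prod_map_togglePerm),
    isRainbow_top_id.comp_voltageLiftHom _⟩
  exact Nat.cast_le.2 (Nat.le_add_right g 2)

end Rainbow

section Frozen

variable {V U : Type*} [Fintype U] {H : SimpleGraph V} {K : SimpleGraph U} {k : ℕ}
  {τ : H.Coloring (Fin k)} {σ σ' : K.Coloring (Fin k)}

theorem eq_of_colouringGraph_adj_of_ne (h : (colouringGraph K k 1).Adj σ σ') {u v : U}
    (hu : σ u ≠ σ' u) (huv : u ≠ v) : σ v = σ' v := by
  by_contra hv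
  exact huv (Finset.card_le_one.1 h.2 u (by simpa using hu) v (by simpa using hv))

theorem IsRainbow.comp_eq_of_adj (hτ : IsRainbow τ) (φ : H →g K) (hσ : ∀ v, σ (φ v) = τ v)
    (h : (colouringGraph K k 1).Adj σ σ') (v : V) : σ' (φ v) = τ v := by
  by_contra hne
  obtain ⟨w, hvw, hw⟩ := hτ v (σ' (φ v)) (Ne.symm hne)
  have hφ : K.Adj (φ v) (φ w) := φ.map_adj hvw
  have hww : σ (φ w) = σ' (φ w) :=
    eq_of_colouringGraph_adj_of_ne h (hσ v ▸ Ne.symm hne) hφ.ne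
  exact σ'.valid hφ (by rw [← hww, hσ, hw])

theorem IsRainbow.isFrozen (hτ : IsRainbow τ) (φ : H →g K) (hσ : ∀ v, σ (φ v) = τ v) (v : V) :
    IsFrozen 1 σ (φ v) := by
  rintro σ' ⟨p⟩
  rw [hσ]
  induction p with
  | nil => exact (hσ v).symm
  | cons hadj _ ih => exact ih (hτ.comp_eq_of_adj φ hσ hadj)

theorem numFrozen_le_card (σ : K.Coloring (Fin k)) : numFrozen σ ≤ Fintype.card U := by
  simpa [numFrozen] using Set.ncard_le_card {v | IsFrozen 1 σ v}

end Frozen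

section Splice

variable {V M Z : Type*} {H : SimpleGraph V} {p : Bool → V} {f : M × Bool → Z} {d k : ℕ}

/-- Delete the edge with ends `p false` and `p true` in each of the copies of `H` indexed by `M`,
and join each loose end `(i, p b)` to the new vertex `f (i, b)`. -/
def spliceGraph (H : SimpleGraph V) (p : Bool → V) (f : M × Bool → Z) :
    SimpleGraph ((M × V) ⊕ Z) where
  Adj
    | .inl a, .inl b => a.1 = b.1 ∧ (H.deleteEdges {s(p false, p true)}).Adj a.2 b.2
    | .inl a, .inr z => ∃ b, a.2 = p b ∧ f (a.1, b) = z
    | .inr z, .inl a => ∃ b, a.2 = p b ∧ f (a.1, b) = z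
    | .inr _, .inr _ => False
  symm := ⟨by
    rintro (a | z) (b | w) h
    exacts [⟨h.1.symm, h.2.symm⟩, h, h, h]⟩
  loopless := ⟨by
    rintro (a | z) h
    exacts [h.2.ne rfl, h]⟩

theorem spliceGraph_adj_inl_inl {a b : M × V} : (spliceGraph H p f).Adj (.inl a) (.inl b) ↔
    a.1 = b.1 ∧ (H.deleteEdges {s(p false, p true)}).Adj a.2 b.2 := Iff.rfl

theorem spliceGraph_adj_inl_inr {a : M × V} {z : Z} :
    (spliceGraph H p f).Adj (.inl a) (.inr z) ↔ ∃ b, a.2 = p b ∧ f (a.1, b) = z := Iff.rfl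

theorem spliceGraph_adj_inr_inl {a : M × V} {z : Z} :
    (spliceGraph H p f).Adj (.inr z) (.inl a) ↔ ∃ b, a.2 = p b ∧ f (a.1, b) = z := Iff.rfl

theorem spliceGraph_not_adj_inr_inr {z w : Z} :
    ¬ (spliceGraph H p f).Adj (.inr z) (.inr w) := id

/-- The copy of `H` indexed by `i`, without its deleted edge, inside the spliced graph. -/
def spliceGraphCopy (H : SimpleGraph V) (p : Bool → V) (f : M × Bool → Z) (i : M) :
    H.deleteEdges {s(p false, p true)} ↪g spliceGraph H p f where
  toFun v := .inl (i, v)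
  inj' _ _ h := (Prod.ext_iff.1 (Sum.inl_injective h)).2
  map_rel_iff' := spliceGraph_adj_inl_inl.trans (and_iff_right rfl)

theorem sym2_apply_not (p : Bool → V) (b : Bool) : s(p b, p !b) = s(p false, p true) := by
  cases b
  exacts [rfl, Sym2.eq_swap]

theorem adj_apply_not (hp : H.Adj (p false) (p true)) (b : Bool) : H.Adj (p b) (p !b) := by
  cases b
  exacts [hp, hp.symm]

theorem injective_of_adj (hp : H.Adj (p false) (p true)) : Function.Injective p :=
  Bool.injective_iff.2 hp.ne

theorem exists_mem_edges_or_support_subset_range (i : M) {v : V} {y : (M × V) ⊕ Z}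
    (q : (spliceGraph H p f).Walk (.inl (i, v)) y) :
    (∃ b, s(.inl (i, p b), .inr (f (i, b))) ∈ q.edges ∧
      ∃ r : (H.deleteEdges {s(p false, p true)}).Walk v (p b), r.length < q.length) ∨
    ∀ u ∈ q.support, u ∈ Set.range (spliceGraphCopy H p f i) := by
  generalize hx : Sum.inl (i, v) = x at q
  induction q generalizing v with
  | nil => exact .inr (List.forall_mem_singleton.2 ⟨v, hx⟩)
  | @cons _ w _ hxw q ih =>
    subst hx
    rcases w with ⟨j, w⟩ | z
    · obtain ⟨hij : i = j, hvw⟩ := spliceGraph_adj_inl_inl.1 hxw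
      subst hij
      rcases ih rfl with ⟨b, hb, r, hr⟩ | hrange
      · exact .inl ⟨b, List.mem_cons_of_mem _ hb, r.cons hvw, Nat.succ_lt_succ hr⟩
      · exact .inr (List.forall_mem_cons.2 ⟨⟨v, rfl⟩, hrange⟩)
    · obtain ⟨b, rfl, rfl⟩ := spliceGraph_adj_inl_inr.1 hxw
      exact .inl ⟨b, List.mem_cons_self, .nil, Nat.succ_pos _⟩

theorem egirth_le_length_of_isCycle_inr (hp : H.Adj (p false) (p true)) {z : Z}
    {c : (spliceGraph H p f).Walk (.inr z) (.inr z)} (hc : c.IsCycle) : H.egirth ≤ c.length := by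
  cases c with
  | nil => exact absurd rfl hc.ne_nil
  | @cons _ w _ hzw q =>
    obtain ⟨-, hq⟩ := (q.cons_isCycle_iff hzw).1 hc
    rcases w with ⟨i, v⟩ | w
    · obtain ⟨b, rfl, rfl⟩ := spliceGraph_adj_inr_inl.1 hzw
      -- The cycle leaves the copy `i` through its other loose end, and the deleted edge closes up
      -- the portion inside the copy.
      rcases exists_mem_edges_or_support_subset_range i q with ⟨b', hb', r, hr⟩ | hrange
      · obtain rfl : b' = !b := Bool.eq_not.2 fun h => hq (by subst h; rwa [Sym2.eq_swap])
        have hr' : s(p !b, p b) ∉ (r.mapLe (H.deleteEdges_le _)).edges := by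
          rw [SimpleGraph.Walk.edges_mapLe_eq_edges]
          intro h
          exact (SimpleGraph.deleteEdges_adj.1 (r.adj_of_mem_edges h)).2
            (Sym2.eq_swap.trans (sym2_apply_not p b))
        calc H.egirth ≤ (r.mapLe (H.deleteEdges_le _)).length + 1 :=
              egirth_le_length_add_one_of_adj (adj_apply_not hp b).symm _ hr'
          _ ≤ (q.cons hzw).length := by
            rw [SimpleGraph.Walk.length_mapLe]
            exact_mod_cast Nat.succ_le_succ hr.le
      · obtain ⟨v, hv⟩ := hrange _ q.end_mem_support
        cases hv
    · exact (spliceGraph_not_adj_inr_inr hzw).elim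

theorem egirth_le_egirth_spliceGraph (hp : H.Adj (p false) (p true)) :
    H.egirth ≤ (spliceGraph H p f).egirth := by
  classical
  rw [SimpleGraph.le_egirth]
  intro x c hc
  by_cases hz : ∃ z, .inr z ∈ c.support
  · obtain ⟨z, hz⟩ := hz
    simpa using egirth_le_length_of_isCycle_inr hp (hc.rotate hz)
  · rcases x with ⟨i, v⟩ | z
    · refine (SimpleGraph.egirth_anti (H.deleteEdges_le _)).trans
        (egirth_le_length_of_support_subset_range (spliceGraphCopy H p f i) hc ?_)
      refine (exists_mem_edges_or_support_subset_range i c).resolve_left ?_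
      rintro ⟨b, hb, -⟩
      exact hz ⟨_, c.snd_mem_support_of_mem_edges hb⟩
    · exact absurd ⟨z, c.start_mem_support⟩ hz

theorem neighborSet_spliceGraph_inr (z : Z) : (spliceGraph H p f).neighborSet (.inr z) =
    (fun x : M × Bool => .inl (x.1, p x.2)) '' (f ⁻¹' {z}) := by
  ext (⟨i, v⟩ | w)
  · constructor
    · rintro ⟨b, rfl, hb⟩
      exact ⟨(i, b), hb, rfl⟩
    · rintro ⟨⟨j, b⟩, hb, h⟩
      cases h
      exact ⟨b, rfl, hb⟩
  · simp [spliceGraph_not_adj_inr_inr]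

theorem neighborSet_spliceGraph_inl (i : M) (v : V) :
    (spliceGraph H p f).neighborSet (.inl (i, v)) =
      .inl '' (Prod.mk i '' (H.deleteEdges {s(p false, p true)}).neighborSet v) ∪
        .inr '' ((fun b => f (i, b)) '' (p ⁻¹' {v})) := by
  ext (⟨j, w⟩ | z)
  · simpa [spliceGraph_adj_inl_inl] using and_comm
  · simp [spliceGraph_adj_inl_inr, eq_comm]

theorem ncard_neighborSet_deleteEdges_add [Finite V] (hp : H.Adj (p false) (p true)) (v : V) :
    ((H.deleteEdges {s(p false, p true)}).neighborSet v).ncard + (p ⁻¹' {v}).ncard =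
      (H.neighborSet v).ncard := by
  by_cases hv : v ∈ Set.range p
  · obtain ⟨b, rfl⟩ := hv
    have hdelete : (H.deleteEdges {s(p false, p true)}).neighborSet (p b) =
        H.neighborSet (p b) \ {p !b} := by
      ext w
      rw [SimpleGraph.mem_neighborSet, SimpleGraph.deleteEdges_adj, ← sym2_apply_not p b,
        Set.mem_singleton_iff, Sym2.congr_right]
      rfl
    have hpreimage : p ⁻¹' {p b} = {b} := by
      ext b'
      exact (injective_of_adj hp).eq_iff
    rw [hdelete, hpreimage, Set.ncard_singleton,
      Set.ncard_sdiff_singleton_add_one ((H.mem_neighborSet _ _).2 (adj_apply_not hp b))]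
  · have hdelete : (H.deleteEdges {s(p false, p true)}).neighborSet v = H.neighborSet v := by
      ext w
      rw [SimpleGraph.mem_neighborSet, SimpleGraph.deleteEdges_adj, SimpleGraph.mem_neighborSet]
      refine and_iff_left fun h => hv ?_
      rcases Sym2.mem_iff.1 ((show s(v, w) = _ from h) ▸ Sym2.mem_mk_left v w) with h | h
      exacts [⟨_, h.symm⟩, ⟨_, h.symm⟩]
    rw [hdelete, Set.preimage_singleton_eq_empty.2 hv, Set.ncard_empty, add_zero]

theorem IsRegularGraph.spliceGraph [Fintype V] [Fintype M] [Fintype Z] (hH : IsRegularGraph H d)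
    (hp : H.Adj (p false) (p true)) (hf : ∀ z, (f ⁻¹' {z}).ncard = d) :
    IsRegularGraph (spliceGraph H p f) d := by
  have hinj := injective_of_adj hp
  rw [isRegularGraph_iff_ncard_neighborSet] at hH ⊢
  rintro (⟨i, v⟩ | z)
  · have hsub : (p ⁻¹' {v}).Subsingleton := Set.subsingleton_singleton.preimage hinj
    rw [neighborSet_spliceGraph_inl, Set.ncard_union_eq (Set.disjoint_image_inl_image_inr ..),
      Set.ncard_image_of_injective _ Sum.inl_injective,
      Set.ncard_image_of_injective _ (Prod.mk_right_injective i),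
      Set.ncard_image_of_injective _ Sum.inr_injective, (hsub.injOn _).ncard_image,
      ncard_neighborSet_deleteEdges_add hp, hH]
  · rw [neighborSet_spliceGraph_inr, Set.ncard_image_of_injective, hf]
    exact Sum.inl_injective.comp (Function.injective_id.prodMap hinj)

theorem nonempty_coloring_spliceGraph [Finite M] (τ : H.Coloring (Fin k))
    (hf : ∀ z, (f ⁻¹' {z}).ncard < k) : Nonempty ((spliceGraph H p f).Coloring (Fin k)) := by
  have hfree : ∀ z, ∃ c, c ∉ (fun x => τ (p x.2)) '' (f ⁻¹' {z}) := by
    intro z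
    rw [← Set.ne_univ_iff_exists_notMem]
    intro huniv
    have hle := (Set.ncard_image_le (f := fun x => τ (p x.2)) (Set.toFinite _)).trans_lt (hf z)
    rw [huniv] at hle
    simp at hle
  choose c hc using hfree
  have hne : ∀ {i : M} {v : V} {z : Z}, (∃ b, v = p b ∧ f (i, b) = z) → τ v ≠ c z := by
    rintro i _ z ⟨b, rfl, hb⟩ h
    exact hc z ⟨(i, b), hb, h⟩
  refine ⟨SimpleGraph.Coloring.mk (Sum.elim (fun a => τ a.2) c) ?_⟩
  rintro (a | z) (b | w) h
  · exact τ.valid (H.deleteEdges_le _ h.2)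
  · exact hne h
  · exact (hne h).symm
  · exact h.elim

end Splice

section Decomposition

variable {V : Type*} [Fintype V] {H : SimpleGraph V} {d k : ℕ}

theorem exists_isRegularGraph_coloring_sum_fin (hH : IsRegularGraph H d) (hdk : d < k)
    (τ : H.Coloring (Fin k)) {u v : V} (huv : H.Adj u v) {m r : ℕ} (hmr : m * 2 = r * d) :
    ∃ A : SimpleGraph ((Fin m × V) ⊕ Fin r),
      IsRegularGraph A d ∧ H.egirth ≤ A.egirth ∧ Nonempty (A.Coloring (Fin k)) := by
  have e : Fin m × Bool ≃ Fin r × Fin d := Fintype.equivOfCardEq (by simpa using hmr)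
  have hfibre : ∀ z, ((fun x => (e x).1) ⁻¹' {z}).ncard = d := by
    intro z
    rw [show (fun x => (e x).1) ⁻¹' {z} = e.symm '' Set.range (Prod.mk z) by
        ext x; simp [Prod.ext_iff, eq_comm],
      Set.ncard_image_of_injective _ e.symm.injective, ← Set.image_univ,
      Set.ncard_image_of_injective _ (Prod.mk_right_injective z), Set.ncard_univ, Nat.card_fin]
  let p : Bool → V := fun b => cond b v u
  have hp : H.Adj (p false) (p true) := huv
  exact ⟨spliceGraph H p fun x => (e x).1, hH.spliceGraph hp hfibre,
    egirth_le_egirth_spliceGraph hp,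
    nonempty_coloring_spliceGraph τ fun z => (hfibre z).trans_lt hdk⟩

/- The `m` spliced copies have `m * 2` loose ends, which provide the `r` new vertices with `d`
neighbours each. -/
theorem exists_eq_mul_add_add_mul {h n : ℕ} (hh : 0 < h) (hdh : Even (d * h))
    (hdn : Even (d * n)) (hn : 2 * (h * h * d + h) ≤ n) :
    ∃ m r q, m * 2 = r * d ∧ n = m * h + r + q * h ∧ n ≤ 2 * (q * h) := by
  have hdiv : n / h * h + n % h = n := Nat.div_add_mod' n h
  have hmod : n % h < h := Nat.mod_lt n hh
  obtain ⟨m, hm⟩ : Even (n % h * d) := by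
    rw [← hdiv, mul_add, mul_left_comm, Nat.even_add] at hdn
    exact mul_comm d _ ▸ hdn.1 (hdh.mul_left _)
  have hmh : m * h ≤ h * h * d := by
    have hmd : m ≤ h * d := by linarith [Nat.mul_le_mul_right d hmod.le]
    linarith [Nat.mul_le_mul_right h hmd]
  obtain ⟨q, hq⟩ := Nat.exists_eq_add_of_le ((Nat.le_div_iff_mul_le hh).2 (by omega : m * h ≤ n))
  rw [hq, add_mul] at hdiv
  exact ⟨m, n % h, q, by omega, by omega, by omega⟩

theorem exists_iso_sum_bot_boxProd (hH : IsRegularGraph H d) (hd : 0 < d) [Nonempty V]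
    (τ : H.Coloring (Fin (d + 1))) {n : ℕ} (hdn : Even (d * n))
    (hn : 2 * (Fintype.card V * Fintype.card V * d + Fintype.card V) ≤ n) :
    ∃ (m r q : ℕ) (A : SimpleGraph ((Fin m × V) ⊕ Fin r)) (K : SimpleGraph (Fin n)),
      Nonempty (K ≃g A ⊕g ((⊥ : SimpleGraph (Fin q)) □ H)) ∧
      Nonempty (A.Coloring (Fin (d + 1))) ∧ IsRegularGraph K d ∧ H.egirth ≤ K.egirth ∧
      n ≤ 2 * (q * Fintype.card V) := by
  obtain ⟨m, r, q, hmr, hcard, hq⟩ :=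
    exists_eq_mul_add_add_mul Fintype.card_pos hH.even_mul_card hdn hn
  obtain ⟨v, huv⟩ := hH.exists_adj hd (Classical.arbitrary V)
  obtain ⟨A, hA, hgirth, hcol⟩ :=
    exists_isRegularGraph_coloring_sum_fin hH d.lt_succ_self τ huv hmr
  have e : Fin n ≃ ((Fin m × V) ⊕ Fin r) ⊕ (Fin q × V) :=
    Fintype.equivOfCardEq (by simpa using hcard)
  let φ := SimpleGraph.Iso.comap e (A ⊕g ((⊥ : SimpleGraph (Fin q)) □ H))
  refine ⟨m, r, q, A, _, ⟨φ⟩, hcol, (hA.sum hH.bot_boxProd).of_iso φ, ?_, hq⟩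
  rw [φ.egirth_eq]
  exact le_egirth_sum hgirth egirth_le_egirth_bot_boxProd

end Decomposition

section Probability

open MeasureTheory ProbabilityTheory

theorem map_snd_equiv_uniformOn_univ {S A T : Type*} [Finite A] [Nonempty A] [Finite T]
    [MeasurableSpace S] [DiscreteMeasurableSpace S] [MeasurableSpace T]
    [MeasurableSingletonClass T] (Φ : S ≃ A × T) :
    (uniformOn (Set.univ : Set S)).map (fun s => (Φ s).2) = uniformOn Set.univ := by
  have := Fintype.ofFinite A
  have := Fintype.ofFinite T
  have := Fintype.ofEquiv _ Φ.symm
  ext t ht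
  have hpreimage : (fun s => (Φ s).2) ⁻¹' t = Φ.symm '' (Set.univ ×ˢ t) := by
    ext s
    simp
  have hcount : Measure.count ((fun s => (Φ s).2) ⁻¹' t) = Fintype.card A * Measure.count t := by
    rw [Measure.count_apply .of_discrete, Measure.count_apply ht, hpreimage,
      Φ.symm.injective.encard_image, Set.encard_prod]
    simp
  rw [Measure.map_apply .of_discrete ht, uniformOn_univ, uniformOn_univ, hcount,
    Fintype.card_congr Φ, Fintype.card_prod, Nat.cast_mul]
  exact ENNReal.mul_div_mul_left _ _ (by simp) (by simp)

variable {Ω ι : Type*} [MeasurableSpace Ω] {μ : Measure Ω} [IsProbabilityMeasure μ] [Fintype ι]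

theorem measureReal_sum_le_sum_integral_sub_le {X : ι → Ω → ℝ} (hX : iIndepFun X μ)
    (hm : ∀ i, AEMeasurable (X i) μ) (h01 : ∀ i, ∀ᵐ ω ∂μ, X i ω ∈ Set.Icc 0 1) {ε : ℝ}
    (hε : 0 ≤ ε) :
    μ.real {ω | ∑ i, X i ω ≤ ∑ i, μ[X i] - ε} ≤ Real.exp (-(2 * ε ^ 2 / Fintype.card ι)) := by
  have hindep : iIndepFun (fun i ω => -(X i ω - μ[X i])) μ :=
    hX.comp (fun i x => -(x - ∫ ω, X i ω ∂μ)) fun i => by fun_prop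
  have hoeffding := HasSubgaussianMGF.measure_sum_ge_le_of_iIndepFun hindep
    (s := Finset.univ) (fun i _ => (hasSubgaussianMGF_of_mem_Icc (hm i) (h01 i)).neg) hε
  convert hoeffding using 2
  · congr! 2 with ω
    simp only [Finset.sum_neg_distrib, Finset.sum_sub_distrib]
    constructor <;> intro h <;> linarith
  · simp
    ring

theorem measureReal_pi_card_mem_le {s : Set Ω} (hs : MeasurableSet s) {δ : ℝ} (hδ : 0 ≤ δ) :
    (Measure.pi fun _ : ι => μ).real
        {x | ({i | x i ∈ s}.ncard : ℝ) ≤ (μ.real s - δ) * Fintype.card ι} ≤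
      Real.exp (-(2 * δ ^ 2 * Fintype.card ι)) := by
  classical
  have hm : Measurable (s.indicator (1 : Ω → ℝ)) := measurable_one.indicator hs
  have hmi : ∀ i : ι, Measurable fun x : ι → Ω => s.indicator (1 : Ω → ℝ) (x i) :=
    fun i => hm.comp (measurable_pi_apply i)
  have hindep : iIndepFun (fun i x => s.indicator (1 : Ω → ℝ) (x i)) (Measure.pi fun _ : ι => μ) :=
    iIndepFun_pi fun _ => hm.aemeasurable
  have hmean : ∀ i : ι, ∫ x, s.indicator (1 : Ω → ℝ) (x i) ∂(Measure.pi fun _ : ι => μ) =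
      μ.real s := by
    intro i
    rw [integral_comp_eval (μ := fun _ : ι => μ) hm.aestronglyMeasurable,
      integral_indicator_one hs]
  have hcount : ∀ x : ι → Ω, ∑ i, s.indicator (1 : Ω → ℝ) (x i) = {i | x i ∈ s}.ncard := by
    intro x
    simp [Set.indicator_apply, Set.ncard_eq_toFinset_card']
  have hoeffding := measureReal_sum_le_sum_integral_sub_le hindep (fun i => (hmi i).aemeasurable)
    (fun i => .of_forall fun x => ⟨Set.indicator_nonneg (by simp) _,
      Set.indicator_le_self' (by simp) _⟩)
    (mul_nonneg hδ (Nat.cast_nonneg (Fintype.card ι)))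
  simp only [hcount, hmean, Finset.sum_const, Finset.card_univ, nsmul_eq_mul] at hoeffding
  convert hoeffding using 2
  · congr! 3
    ring
  · rw [mul_pow, sq (Fintype.card ι : ℝ), ← mul_assoc, mul_div_assoc, mul_self_div_self]

end Probability

section Copies

open MeasureTheory ProbabilityTheory

instance discreteMeasurableSpace_coloring {V : Type*} (G : SimpleGraph V) (k : ℕ) :
    DiscreteMeasurableSpace (G.Coloring (Fin k)) := ⟨fun _ => trivial⟩

instance finite_coloring {V : Type*} [Finite V] (G : SimpleGraph V) (k : ℕ) :
    Finite (G.Coloring (Fin k)) := DFunLike.finite _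

instance isZeroOrProbabilityMeasure_uniformColouring {V : Type*} (G : SimpleGraph V) (k : ℕ) :
    IsZeroOrProbabilityMeasure (uniformColouring G k) :=
  inferInstanceAs (IsZeroOrProbabilityMeasure (cond _ _))

instance isProbabilityMeasure_uniformColouring {V : Type*} [Finite V] (G : SimpleGraph V) (k : ℕ)
    [Nonempty (G.Coloring (Fin k))] : IsProbabilityMeasure (uniformColouring G k) :=
  inferInstanceAs (IsProbabilityMeasure (uniformOn Set.univ))

theorem measureReal_uniformColouring_singleton_pos {V : Type*} [Finite V] {G : SimpleGraph V}
    {k : ℕ} (τ : G.Coloring (Fin k)) : 0 < (uniformColouring G k).real {τ} := by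
  have := Fintype.ofFinite (G.Coloring (Fin k))
  have : Nonempty (G.Coloring (Fin k)) := ⟨τ⟩
  rw [uniformColouring, measureReal_def, uniformOn_univ, Measure.count_singleton]
  exact ENNReal.toReal_pos (by simp) (by simp)

variable {ι U V W C : Type*} {K : SimpleGraph U} {A : SimpleGraph W} {H : SimpleGraph V}

/-- Colouring the disjoint copies of `H` indexed by `ι` amounts to colouring each of them. -/
def coloringBotBoxProdEquiv : ((⊥ : SimpleGraph ι) □ H).Coloring C ≃ (ι → H.Coloring C) where
  toFun σ i := σ.comp (SimpleGraph.boxProdRight ⊥ H i).toHom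
  invFun τ := SimpleGraph.Coloring.mk (fun a => τ a.1 a.2) fun {a b} h => by
    obtain ⟨i, v⟩ := a
    obtain ⟨j, w⟩ := b
    obtain ⟨hvw, rfl⟩ : H.Adj v w ∧ i = j := by simpa [SimpleGraph.boxProd_adj] using h
    exact (τ i).valid hvw
  left_inv _ := rfl
  right_inv _ := rfl

/-- A colouring of a graph isomorphic to the disjoint union of `A` with copies of `H` amounts to a
colouring of `A` and a colouring of each copy. -/
def coloringSumCopiesEquiv (φ : K ≃g A ⊕g ((⊥ : SimpleGraph ι) □ H)) :
    K.Coloring C ≃ A.Coloring C × (ι → H.Coloring C) :=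
  (SimpleGraph.coloringCongr φ (.refl C)).trans <|
    SimpleGraph.Coloring.sumEquiv.trans <| (Equiv.refl _).prodCongr coloringBotBoxProdEquiv

theorem coloringSumCopiesEquiv_snd_apply (φ : K ≃g A ⊕g ((⊥ : SimpleGraph ι) □ H))
    (σ : K.Coloring C) (i : ι) (v : V) :
    (coloringSumCopiesEquiv φ σ).2 i v = σ (φ.symm (.inr (i, v))) := rfl

theorem IsRainbow.ncard_mul_card_le_numFrozen [Fintype U] [Fintype V] {k : ℕ}
    {τ : H.Coloring (Fin k)} (hτ : IsRainbow τ) (φ : K ≃g A ⊕g ((⊥ : SimpleGraph ι) □ H))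
    (σ : K.Coloring (Fin k)) :
    {i | (coloringSumCopiesEquiv φ σ).2 i = τ}.ncard * Fintype.card V ≤ numFrozen σ := by
  have hfrozen : (fun a : ι × V => φ.symm (.inr a)) ''
      ({i | (coloringSumCopiesEquiv φ σ).2 i = τ} ×ˢ Set.univ) ⊆ {v | IsFrozen 1 σ v} := by
    rintro _ ⟨⟨i, v⟩, ⟨rfl, -⟩, rfl⟩
    exact hτ.isFrozen ((φ.symm.toHom.comp SimpleGraph.Embedding.sumInr.toHom).comp
      (SimpleGraph.boxProdRight ⊥ H i).toHom)
      (fun w => (coloringSumCopiesEquiv_snd_apply φ σ i w).symm) v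
  rw [← Nat.card_eq_fintype_card, ← Set.ncard_univ, ← Set.ncard_prod,
    ← Set.ncard_image_of_injective _ (φ.symm.injective.comp Sum.inr_injective)]
  exact Set.ncard_le_ncard hfrozen

theorem map_coloringSumCopiesEquiv_snd_uniformColouring [Fintype ι] [Finite V] [Finite W]
    {k : ℕ} [Nonempty (A.Coloring (Fin k))]
    (φ : K ≃g A ⊕g ((⊥ : SimpleGraph ι) □ H)) :
    (uniformColouring K k).map (fun σ => (coloringSumCopiesEquiv φ σ).2) =
      Measure.pi fun _ => uniformColouring H k := by
  simp only [uniformColouring, ← uniformOn_pi, Set.pi_univ]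
  exact map_snd_equiv_uniformOn_univ _

theorem IsRainbow.measureReal_numFrozen_lt_le [Fintype ι] [Fintype U]
    [Fintype V] [Finite W] {k : ℕ} [Nonempty (A.Coloring (Fin k))] {τ : H.Coloring (Fin k)}
    (hτ : IsRainbow τ) (φ : K ≃g A ⊕g ((⊥ : SimpleGraph ι) □ H)) {δ : ℝ} (hδ : 0 ≤ δ) :
    (uniformColouring K k).real {σ | (numFrozen σ : ℝ) <
        ((uniformColouring H k).real {τ} - δ) * Fintype.card ι * Fintype.card V} ≤
      Real.exp (-(2 * δ ^ 2 * Fintype.card ι)) := by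
  have : Nonempty (H.Coloring (Fin k)) := ⟨τ⟩
  refine le_trans ?_ (measureReal_pi_card_mem_le (μ := uniformColouring H k) (ι := ι)
    (.of_discrete (s := {τ})) hδ)
  rw [← map_coloringSumCopiesEquiv_snd_uniformColouring φ,
    map_measureReal_apply .of_discrete .of_discrete]
  refine measureReal_mono fun σ hσ => ?_
  have hle : ({i | (coloringSumCopiesEquiv φ σ).2 i = τ}.ncard : ℝ) * Fintype.card V ≤
      numFrozen σ := by exact_mod_cast hτ.ncard_mul_card_le_numFrozen φ σ
  exact (lt_of_mul_lt_mul_right (hle.trans_lt hσ) (Nat.cast_nonneg _)).le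

end Copies

section Main

open Filter MeasureTheory

theorem exists_isRegularGraph_le_numFrozen (g d : ℕ) (hd : 0 < d) :
    ∃ b c : ℝ, 0 < b ∧ 0 < c ∧ ∃ N : ℕ, ∀ n ≥ N, Even (d * n) → ∃ K : SimpleGraph (Fin n),
      IsRegularGraph K d ∧ g ≤ K.egirth ∧
      1 - Real.exp (-(b * n)) ≤ (uniformColouring K (d + 1)).real {σ | c * n ≤ numFrozen σ} := by
  obtain ⟨V, _, _, H, τ, hreg, hgirth, hτ⟩ := exists_isRegularGraph_isRainbow g d
  set h := Fintype.card V
  have hh : (0 : ℝ) < h := Nat.cast_pos.2 Fintype.card_pos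
  set p := (uniformColouring H (d + 1)).real {τ}
  have hp : 0 < p := measureReal_uniformColouring_singleton_pos τ
  refine ⟨p ^ 2 / (4 * h), p / 4, by positivity, by positivity, 2 * (h * h * d + h), ?_⟩
  intro n hn hdn
  obtain ⟨m, r, q, A, K, ⟨φ⟩, _, hK, hKgirth, hq⟩ := exists_iso_sum_bot_boxProd hreg hd τ hdn hn
  have hq : (n : ℝ) ≤ 2 * (q * h) := by exact_mod_cast hq
  have hbound := hτ.measureReal_numFrozen_lt_le φ (half_pos hp).le
  rw [Fintype.card_fin] at hbound
  have : Nonempty (K.Coloring (Fin (d + 1))) :=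
    ⟨(coloringSumCopiesEquiv φ).symm (Classical.arbitrary _, fun _ => τ)⟩
  refine ⟨K, hK, hgirth.trans hKgirth, ?_⟩
  rw [sub_le_comm, ← probReal_compl_eq_one_sub .of_discrete]
  refine (measureReal_mono fun σ hσ => ?_).trans (hbound.trans (Real.exp_le_exp.2 (neg_le_neg ?_)))
  · calc (numFrozen σ : ℝ) < p / 4 * n := not_le.1 hσ
      _ ≤ p / 4 * (2 * (q * h)) := by gcongr
      _ = (p - p / 2) * q * h := by ring
  · calc p ^ 2 / (4 * h) * n ≤ p ^ 2 / (4 * h) * (2 * (q * h)) := by gcongr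
      _ = 2 * (p / 2) ^ 2 * q := by field_simp; ring

theorem tendsto_ofReal_one_sub_exp_neg_mul {b : ℝ} (hb : 0 < b) :
    Tendsto (fun n : ℕ => ENNReal.ofReal (1 - Real.exp (-(b * n)))) atTop (nhds 1) := by
  have hexp : Tendsto (fun n : ℕ => Real.exp (-(b * n))) atTop (nhds 0) :=
    Real.tendsto_exp_neg_atTop_nhds_zero.comp (tendsto_natCast_atTop_atTop.const_mul_atTop hb)
  simpa using ENNReal.tendsto_ofReal (hexp.const_sub 1)

theorem mainTheorem11_general (g d : ℕ) (hd : 0 < d) :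
    ∃ c C : ℝ, 0 < c ∧ 0 < C ∧ ∃ G : (n : ℕ) → SimpleGraph (Fin n),
      (∃ N : ℕ, ∀ n : ℕ, N ≤ n → Even (d * n) →
        IsRegularGraph (G n) d ∧ (g : ℕ∞) ≤ (G n).egirth) ∧
      Filter.Tendsto
        (fun n : ℕ => uniformColouring (G n) (d + 1)
          {σ | c * (n : ℝ) ≤ (numFrozen σ : ℝ) ∧ (numFrozen σ : ℝ) ≤ C * (n : ℝ)})
        (Filter.atTop ⊓ Filter.principal {n : ℕ | Even (d * n)}) (nhds 1) := by
  obtain ⟨b, c, hb, hc, N, hgraph⟩ := exists_isRegularGraph_le_numFrozen g d hd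
  choose! G hreg hgirth hfrozen using hgraph
  refine ⟨c, 1, hc, one_pos, G, ⟨N, fun n hn hdn => ⟨hreg n hn hdn, hgirth n hn hdn⟩⟩, ?_⟩
  have hupper : ∀ (n : ℕ) (σ : (G n).Coloring (Fin (d + 1))), (numFrozen σ : ℝ) ≤ 1 * n := by
    intro n σ
    simpa using numFrozen_le_card σ
  simp only [hupper, and_true]
  refine tendsto_of_tendsto_of_tendsto_of_le_of_le'
    ((tendsto_ofReal_one_sub_exp_neg_mul hb).mono_left inf_le_left) tendsto_const_nhds ?_
    (.of_forall fun n => prob_le_one)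
  rw [eventually_inf_principal]
  filter_upwards [eventually_ge_atTop N] with n hn hdn
  exact ENNReal.ofReal_le_of_le_toReal (hfrozen n hn hdn)

end Main

theorem mainTheorem11 (g : ℕ) (hg : 3 ≤ g) (d : ℕ) (hd : 3 ≤ d) :
    ∃ c C : ℝ, 0 < c ∧ 0 < C ∧ ∃ G : (n : ℕ) → SimpleGraph (Fin n),
      (∃ N : ℕ, ∀ n : ℕ, N ≤ n → Even (d * n) →
        IsRegularGraph (G n) d ∧ (g : ℕ∞) ≤ (G n).egirth) ∧
      Filter.Tendsto
        (fun n : ℕ => uniformColouring (G n) (d + 1)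
          {σ | c * (n : ℝ) ≤ (numFrozen σ : ℝ) ∧ (numFrozen σ : ℝ) ≤ C * (n : ℝ)})
        (Filter.atTop ⊓ Filter.principal {n : ℕ | Even (d * n)}) (nhds 1) :=
  mainTheorem11_general g d (by omega)
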